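/- For a set $G$ of functions $g:\mathbb{R}^{k_g}\to\mathbb{R}$ and a set $P\subseteq\mathbb{R}$, let $\mathcal{F}(G,P)\subseteq\mathbb{R}$ denote the inclusion-least set that contains $P$ and satisfies: whenever $g\in G$, $x_1,\ldots,x_{k_g}\in\mathcal{F}(G,P)$ and $g(x_1,\ldots,x_{k_g})>\max\{x_1,\ldots,x_{k_g}\}$, then $g(x_1,\ldots,x_{k_g})\in\mathcal{F}(G,P)$. A function $g:\mathbb{R}^n\to\mathbb{R}$ is called monotone if $g(x_1,\ldots,x_n)\le g(y_1,\ldots,y_n)$ whenever $x_i\le y_i$ for all $i$. For $N\ge 1$ the $N$-ary Veblen function $\varphi$ on ordinals is defined by recursion along the lexicographic order of its arguments: $\varphi(0,\ldots,0,\beta)=\omega^\beta$; and if $1\le k\le N-1$ and $\alpha_k>0$, then $\beta\mapsto\varphi(\alpha_1,\ldots,\alpha_k,0,\ldots,0,\beta)$ enumerates in increasing order the common fixed points of the functions $\gamma\mapsto\varphi(\alpha_1,\ldots,\alpha_{k-1},\alpha'_k,\gamma,0,\ldots,0)$ for $\alpha'_k<\alpha_k$. Theorem. For each $n\ge 3$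 there exists a continuous monotone function $g:\mathbb{R}^n\to\mathbb{R}$ such that the set $\mathcal{F}(\{g\},\{0\})$, with the usual order of the reals, is well ordered and has order type $\varphi(1,\underbrace{0,\ldots,0}_{n\text{ times}})$, where $\varphi$ is the $(n+1)$-ary Veblen function. -/

import Mathlib

open Ordinal

universe u

/-- The tuple `(a_1, …, a_{k-1}, x, γ, 0, …, 0)`, obtained from `a` by replacing its `k`-th entry
by `x`, the next one by `γ`, and all later ones by `0`. -/
def veblenArg {m : ℕ} (a : Fin (m + 1) → Ordinal.{u}) (k : Fin m) (x γ : Ordinal.{u}) :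
    Fin (m + 1) → Ordinal.{u} :=
  fun i => if i < k.castSucc then a i else if i = k.castSucc then x
    else if i = k.succ then γ else 0

theorem veblenArg_lt {m : ℕ} (a : Fin (m + 1) → Ordinal.{u}) (k : Fin m) (x γ : Ordinal.{u})
    (hx : x < a k.castSucc) : toLex (veblenArg a k x γ) < toLex a := by
  refine ⟨k.castSucc, fun j hj => ?_, ?_⟩
  · change veblenArg a k x γ j = a j
    exact if_pos hj
  · simpa [veblenArg] using hx

/-- The lexicographic order of tuples of ordinals is well founded. -/
instance veblenLexWellFounded {m : ℕ} :
    WellFoundedRelation (Lex (Fin (m + 1) → Ordinal.{u})) where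
  rel := (· < ·)
  wf := wellFounded_lt

/-- Among the entries of `a` other than the final one, the `k`-th is the last nonzero entry. -/
def IsLastNonzero {m : ℕ} (a : Fin (m + 1) → Ordinal.{u}) (k : Fin m) : Prop :=
  a k.castSucc ≠ 0 ∧ ∀ j : Fin m, k < j → a j.castSucc = 0

open Classical in
/-- The `(m + 1)`-ary Veblen function `φ`. One has `φ(0, …, 0, β) = ω ^ β`, and if `a_k ≠ 0` then
`β ↦ φ(a_1, …, a_k, 0, …, 0, β)` enumerates the common fixed points of the functions
`γ ↦ φ(a_1, …, a_{k-1}, x, γ, 0, …, 0)` for `x < a_k`. The recursion is along the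
lexicographic order of the tuples. -/
noncomputable def multiVeblen {m : ℕ} (a : Fin (m + 1) → Ordinal.{u}) : Ordinal.{u} :=
  if ∀ k : Fin m, a k.castSucc = 0 then ω ^ a (Fin.last m)
  else enumOrd {γ | ∀ k : Fin m, IsLastNonzero a k → ∀ x : Ordinal.{u}, x < a k.castSucc →
    multiVeblen (veblenArg a k x γ) = γ} (a (Fin.last m))
termination_by toLex a
decreasing_by exact veblenArg_lt a _ _ _ (by assumption)

/-- `InFriedmanSet G P z` says that `z` lies in `𝓕(G, P)`, the inclusion-least set of reals that
contains `P` and contains `g(x_1, …, x_k)` whenever `g ∈ G` is a `k`-ary function,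
`x_1, …, x_k` are in the set and `g(x_1, …, x_k)` is larger than each of `x_1, …, x_k`. -/
inductive InFriedmanSet (G : Set (Σ k : ℕ, (Fin k → ℝ) → ℝ)) (P : Set ℝ) : ℝ → Prop
  | base (p : ℝ) (hp : p ∈ P) : InFriedmanSet G P p
  | app (k : ℕ) (g : (Fin k → ℝ) → ℝ) (hg : Sigma.mk k g ∈ G) (x : Fin k → ℝ)
      (hx : ∀ i, InFriedmanSet G P (x i)) (hlt : ∀ i, x i < g x) : InFriedmanSet G P (g x)

/-- The set `𝓕(G, P)`. -/
def friedmanSet (G : Set (Σ k : ℕ, (Fin k → ℝ) → ℝ)) (P : Set ℝ) : Set ℝ :=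
  {z | InFriedmanSet G P z}

/-- The set `S` of reals, with its usual order, is well ordered and has order type `o`. -/
def HasOrderType (S : Set ℝ) (o : Ordinal.{0}) : Prop :=
  ∃ _ : IsWellOrder S (· < ·), Ordinal.type (α := S) (· < ·) = o

/-! Let `l = φ(1, 0, …, 0)`. It suffices to find a monotone `n`-ary operation on the ordinals below
`l` for which every nonzero ordinal is a value at strictly smaller arguments
(`exists_addVeblen_eq`), and then to realize it on the reals.

The operation combines addition in two coordinates with the `n`-ary Veblen function. An ordinal that
is not additively indecomposable is a sum of two smaller ones. An indecomposable `ζ > 1` that is not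
a Veblen value at smaller arguments would be closed under `φ`; normality then gives `φ(ζ, 0, …, 0) =
ζ`, so `l ≤ ζ` (`exists_multiVeblen_eq`). The leading coordinate is shifted by one, so that `0`
there switches the Veblen term off; this switch and two summands account for `n ≥ 3`. Monotonicity
of `φ` in all arguments jointly (`multiVeblen_monotone`) rests on normality and on the fixed point
identities.

For the realization, generation by a finitary operation makes the order countable, so it embeds into
the reals by partial sums of a summable positive weight `w`. Each set `{s | c ≤ h s}` is an upper
set in a finite power of a well order, so it has finitely many minimal elements and a continuous
monotone indicator. Adding these with weights `w c` gives `g`. -/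

/-- The tuple `(a_0, …, a_{j-1}, γ, 0, …, 0)`. -/
def prefixArg {m : ℕ} (a : Fin (m + 1) → Ordinal.{u}) (j : Fin (m + 1)) (γ : Ordinal.{u}) :
    Fin (m + 1) → Ordinal.{u} :=
  fun i => if i < j then a i else if i = j then γ else 0

/-! ### Tuples with a prescribed prefix -/

section prefixArg

variable {m : ℕ} {a b : Fin (m + 1) → Ordinal.{u}}

theorem prefixArg_of_lt {i j : Fin (m + 1)} (γ : Ordinal.{u}) (h : i < j) :
    prefixArg a j γ i = a i := if_pos h

theorem prefixArg_self (j : Fin (m + 1)) (γ : Ordinal.{u}) : prefixArg a j γ j = γ := by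
  simp [prefixArg]

theorem prefixArg_of_gt {i j : Fin (m + 1)} (γ : Ordinal.{u}) (h : j < i) :
    prefixArg a j γ i = 0 := by
  simp [prefixArg, h.not_gt, h.ne']

theorem prefixArg_congr {j : Fin (m + 1)} (h : ∀ i < j, a i = b i) (γ : Ordinal.{u}) :
    prefixArg a j γ = prefixArg b j γ := by
  funext i
  by_cases hi : i < j <;> simp [prefixArg, hi, h i]

theorem prefixArg_last (a : Fin (m + 1) → Ordinal.{u}) :
    prefixArg a (Fin.last m) (a (Fin.last m)) = a := by
  funext i
  rcases (Fin.le_last i).lt_or_eq with h | rfl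
  · exact prefixArg_of_lt _ h
  · exact prefixArg_self _ _

theorem prefixArg_succ_zero (k : Fin m) (a : Fin (m + 1) → Ordinal.{u}) :
    prefixArg a k.succ 0 = prefixArg a k.castSucc (a k.castSucc) := by
  funext i
  rcases lt_trichotomy i k.castSucc with h | rfl | h
  · rw [prefixArg_of_lt _ h, prefixArg_of_lt _ (h.trans (Fin.castSucc_lt_succ))]
  · rw [prefixArg_self, prefixArg_of_lt _ (Fin.castSucc_lt_succ)]
  · rw [prefixArg_of_gt _ h]
    simp [prefixArg, (Fin.castSucc_lt_iff_succ_le.1 h).not_gt]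

theorem veblenArg_eq_prefixArg (k : Fin m) (x γ : Ordinal.{u}) :
    veblenArg a k x γ = prefixArg (Function.update a k.castSucc x) k.succ γ := by
  funext i
  rcases lt_trichotomy i k.castSucc with h | rfl | h
  · rw [prefixArg_of_lt _ (h.trans (Fin.castSucc_lt_succ)), Function.update_of_ne h.ne]
    exact if_pos h
  · rw [prefixArg_of_lt _ (Fin.castSucc_lt_succ), Function.update_self]
    simp [veblenArg]
  · have := (Fin.castSucc_lt_iff_succ_le.1 h).not_gt
    simp [veblenArg, prefixArg, h.not_gt, h.ne', this]

theorem veblenArg_eq_prefixArg_of_eq {k : Fin m} {x : Ordinal.{u}}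
    (h : ∀ i < k.castSucc, b i = a i) (hx : b k.castSucc = x) (γ : Ordinal.{u}) :
    veblenArg a k x γ = prefixArg b k.succ γ := by
  rw [veblenArg_eq_prefixArg]
  refine prefixArg_congr (fun i hi => ?_) γ
  rcases (Fin.le_castSucc_iff.2 hi).lt_or_eq with h' | rfl
  · rw [Function.update_of_ne h'.ne, h i h']
  · rw [Function.update_self, hx]

theorem veblenArg_congr {k : Fin m} (h : ∀ i < k.castSucc, a i = b i) (x γ : Ordinal.{u}) :
    veblenArg a k x γ = veblenArg b k x γ := by
  funext i
  by_cases hi : i < k.castSucc <;> simp [veblenArg, hi, h i]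

theorem isLastNonzero_prefixArg {k : Fin m} {γ : Ordinal.{u}} (hγ : γ ≠ 0) :
    IsLastNonzero (prefixArg a k.castSucc γ) k := by
  refine ⟨by rwa [prefixArg_self], fun j hj => prefixArg_of_gt _ (by simpa using hj)⟩

theorem IsLastNonzero.unique {k l : Fin m} (hk : IsLastNonzero a k) (hl : IsLastNonzero a l) :
    k = l := by
  rcases lt_trichotomy k l with h | h | h
  · exact absurd (hk.2 l h) hl.1
  · exact h
  · exact absurd (hl.2 k h) hk.1

theorem exists_isLastNonzero {k : Fin m} (hk : a k.castSucc ≠ 0) :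
    ∃ l, k ≤ l ∧ IsLastNonzero a l := by
  classical
  obtain ⟨l, hl, hmax⟩ := (Finset.univ.filter fun j : Fin m => a j.castSucc ≠ 0).exists_max_image
    id ⟨k, by simpa using hk⟩
  simp only [Finset.mem_filter, Finset.mem_univ, true_and, id] at hl hmax
  refine ⟨l, hmax k hk, hl, fun j hj => ?_⟩
  by_contra h
  exact (hmax j h).not_gt hj

end prefixArg

theorem toLex_pi_induction {m : ℕ} {P : (Fin (m + 1) → Ordinal.{u}) → Prop}
    (h : ∀ a, (∀ b, toLex b < toLex a → P b) → P a) (a : Fin (m + 1) → Ordinal.{u}) : P a :=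
  (InvImage.wf toLex (wellFounded_lt (α := Lex (Fin (m + 1) → Ordinal.{u})))).induction a h

/-! ### Common fixed points of normal functions -/

section commonFixedPoints

variable {f : Ordinal.{u} → Ordinal.{u} → Ordinal.{u}} {o : Ordinal.{u}}

theorem not_bddAbove_commonFixedPoints (hf : ∀ x < o, Order.IsNormal (f x)) :
    ¬ BddAbove {γ | ∀ x < o, f x γ = γ} := by
  have := not_bddAbove_fp_family (f := fun x : Set.Iio o => f x) fun x => hf x x.2
  convert! this using 2
  ext γ
  simp [Function.fixedPoints, Function.IsFixedPt]

theorem isNormal_enumOrd_commonFixedPoints (hf : ∀ x < o, Order.IsNormal (f x)) :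
    Order.IsNormal (enumOrd {γ | ∀ x < o, f x γ = γ}) := by
  have := derivFamily_eq_enumOrd (f := fun x : Set.Iio o => f x) fun x => hf x x.2
  have h : {γ | ∀ x < o, f x γ = γ} = ⋂ x : Set.Iio o, Function.fixedPoints (f x) := by
    ext γ
    simp [Function.fixedPoints, Function.IsFixedPt]
  rw [h, ← this]
  exact isNormal_derivFamily _

/-- If `F x = f x 0` and `F γ` is the least common fixed point of the normal functions `f x` for
`x < γ`, then `F` is normal. -/
theorem isNormal_of_isLeast_commonFixedPoints {F : Ordinal.{u} → Ordinal.{u}}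
    (hf : ∀ x, Order.IsNormal (f x)) (h0 : ∀ x, f x 0 = F x) (hne : ∀ x, F x ≠ 0)
    (hF : ∀ γ ≠ 0, IsLeast {δ | ∀ x < γ, f x δ = δ} (F γ)) : Order.IsNormal F := by
  have hmono : StrictMono F := fun x y hxy => by
    rw [← h0 x, ← (hF y hxy.ne_bot).1 x hxy]
    exact (hf x).strictMono (pos_iff_ne_zero.2 (hne y))
  refine Order.isNormal_iff.2 ⟨hmono, fun o ho b hb => ?_⟩
  have ho0 : 0 < o := by simpa [pos_iff_ne_zero] using ho.ne_bot
  have : Nonempty (Set.Iio o) := ⟨⟨0, ho0⟩⟩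
  have hbdd : BddAbove (Set.range fun y : Set.Iio o => F y) :=
    ⟨b, by rintro _ ⟨y, rfl⟩; exact hb y y.2⟩
  -- By leastness of `F o`, continuity at a limit only requires the supremum of the earlier values
  -- to be a common fixed point. It is one because `F z` is fixed by `f x` as soon as `z > x`, and
  -- such `z` are cofinal in `o`.
  suffices hfix : ∀ x < o, f x (⨆ y : Set.Iio o, F y) = ⨆ y : Set.Iio o, F y from
    ((hF o ho0.ne').2 hfix).trans (ciSup_le fun y => hb y y.2)
  intro x hx
  refine le_antisymm ?_ (hf x).strictMono.le_apply
  rw [(hf x).map_iSup hbdd]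
  refine ciSup_le fun y => ?_
  have hz : max x y < o := max_lt hx y.2
  have hz' : Order.succ (max x y) < o := ho.succ_lt hz
  calc f x (F y) ≤ f x (F (Order.succ (max x y))) :=
        (hf x).monotone (hmono.monotone ((le_max_right _ _).trans (Order.le_succ _)))
    _ = F (Order.succ (max x y)) := (hF _ (Order.succ_ne_bot _)).1 x
        (Order.lt_succ_of_le (le_max_left _ _))
    _ ≤ _ := le_ciSup hbdd ⟨_, hz'⟩

end commonFixedPoints

/-! ### Normality, fixed point identities and monotonicity of the Veblen function -/

section multiVeblen

variable {m : ℕ} {a b : Fin (m + 1) → Ordinal.{u}}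

theorem multiVeblen_of_forall_eq_zero (h : ∀ k : Fin m, a k.castSucc = 0) :
    multiVeblen a = ω ^ a (Fin.last m) := by
  rw [multiVeblen, if_pos h]

theorem multiVeblen_of_isLastNonzero {k : Fin m} (hk : IsLastNonzero a k) :
    multiVeblen a = enumOrd {γ | ∀ x < a k.castSucc, multiVeblen (veblenArg a k x γ) = γ}
      (a (Fin.last m)) := by
  rw [multiVeblen, if_neg fun h => hk.1 (h k)]
  congr 1
  ext γ
  refine ⟨fun h x hx => h k hk x hx, fun h l hl => ?_⟩
  obtain rfl := hk.unique hl
  exact h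

/-- In the last variable the function is `ω ^ γ` or an enumeration of common fixed points of normal
functions. In an earlier variable its values at `γ ≠ 0` are least common fixed points, and
`isNormal_of_isLeast_commonFixedPoints` applies. That criterion needs nonzero values, hence the
second conjunct. -/
theorem isNormal_multiVeblen_aux (p : (Fin (m + 1) → Ordinal.{u}) × Fin (m + 1)) :
    Order.IsNormal (fun γ => multiVeblen (prefixArg p.1 p.2 γ)) ∧
      multiVeblen (prefixArg p.1 p.2 0) ≠ 0 := by
  -- The free coordinate and those after it count as `⊤`, so fixing the free coordinate to any
  -- ordinal and freeing the next one decreases the measure.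
  let μ : (Fin (m + 1) → Ordinal.{u}) × Fin (m + 1) → Lex (Fin (m + 1) → WithTop Ordinal.{u}) :=
    fun p => toLex fun i => if i < p.2 then (p.1 i : WithTop Ordinal.{u}) else ⊤
  induction p using (InvImage.wf μ wellFounded_lt).induction with
  | _ p ih =>
  obtain ⟨a, j⟩ := p
  have step : ∀ (k : Fin m) (x : Ordinal.{u}), k.castSucc ≤ j →
      (k.castSucc < j → x < a k.castSucc) →
      Order.IsNormal (fun γ => multiVeblen (veblenArg a k x γ)) ∧
        multiVeblen (veblenArg a k x 0) ≠ 0 := by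
    intro k x hkj hx
    have := ih (Function.update a k.castSucc x, k.succ) ⟨k.castSucc, fun i hi => ?_, ?_⟩
    · simpa only [veblenArg_eq_prefixArg] using this
    · simp [μ, hi.trans_le hkj, hi.ne, (hi.trans Fin.castSucc_lt_succ)]
    · by_cases h : k.castSucc < j
      · simpa [μ, h] using hx h
      · simp [μ, h]
  dsimp only
  rcases Fin.eq_castSucc_or_eq_last j with ⟨k, rfl⟩ | rfl
  · have h0 : ∀ x, multiVeblen (veblenArg a k x 0) = multiVeblen (prefixArg a k.castSucc x) := by
      intro x
      rw [veblenArg_eq_prefixArg, prefixArg_succ_zero, Function.update_self]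
      congr 1
      exact prefixArg_congr (fun i hi => Function.update_of_ne hi.ne _ _) _
    have hs : ∀ x, _ := fun x => step k x le_rfl fun h => absurd h (lt_irrefl _)
    refine ⟨isNormal_of_isLeast_commonFixedPoints (fun x => (hs x).1) h0
      (fun x => (h0 x) ▸ (hs x).2) fun γ hγ => ?_, (h0 0) ▸ (hs 0).2⟩
    have hlast : prefixArg a k.castSucc γ (Fin.last m) = 0 :=
      prefixArg_of_gt _ (Fin.castSucc_lt_last k)
    rw [multiVeblen_of_isLastNonzero (isLastNonzero_prefixArg hγ), hlast, prefixArg_self]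
    have hc : ∀ x δ, veblenArg (prefixArg a k.castSucc γ) k x δ = veblenArg a k x δ :=
      fun x δ => veblenArg_congr (fun i hi => prefixArg_of_lt _ hi) x δ
    simp only [hc]
    have hnb := not_bddAbove_commonFixedPoints (o := γ) fun x _ => (hs x).1
    refine ⟨enumOrd_mem hnb 0, fun δ hδ => ?_⟩
    obtain ⟨o, rfl⟩ := enumOrd_surjective hnb hδ
    exact (enumOrd_strictMono hnb).monotone (zero_le (a := o))
  · by_cases h : ∀ k : Fin m, a k.castSucc = 0
    · have : ∀ γ, multiVeblen (prefixArg a (Fin.last m) γ) = ω ^ γ := fun γ => by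
        rw [multiVeblen_of_forall_eq_zero, prefixArg_self]
        intro k
        rw [prefixArg_of_lt _ (Fin.castSucc_lt_last k), h k]
      simp only [this]
      exact ⟨isNormal_opow one_lt_omega0, by simp⟩
    · push Not at h
      obtain ⟨k', hk'⟩ := h
      obtain ⟨k, -, hk⟩ := exists_isLastNonzero hk'
      have hs : ∀ x < a k.castSucc, _ := fun x hx =>
        step k x (Fin.castSucc_lt_last k).le fun _ => hx
      have heq : ∀ γ, multiVeblen (prefixArg a (Fin.last m) γ) =
          enumOrd {γ | ∀ x < a k.castSucc, multiVeblen (veblenArg a k x γ) = γ} γ := by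
        intro γ
        have hp : ∀ k : Fin m, prefixArg a (Fin.last m) γ k.castSucc = a k.castSucc :=
          fun k => prefixArg_of_lt _ (Fin.castSucc_lt_last k)
        have : IsLastNonzero (prefixArg a (Fin.last m) γ) k := by
          simpa only [IsLastNonzero, hp] using hk
        rw [multiVeblen_of_isLastNonzero this, prefixArg_self, hp]
        congr 1
        ext δ
        refine forall₂_congr fun x _ => ?_
        rw [veblenArg_congr fun i hi => prefixArg_of_lt _ (hi.trans (Fin.castSucc_lt_last k))]
      simp only [heq]
      refine ⟨isNormal_enumOrd_commonFixedPoints fun x hx => (hs x hx).1, fun h0 => ?_⟩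
      have hpos : 0 < a k.castSucc := pos_iff_ne_zero.2 hk.1
      have := enumOrd_mem (not_bddAbove_commonFixedPoints fun x hx => (hs x hx).1) 0 0 hpos
      rw [h0] at this
      exact (hs 0 hpos).2 this

theorem isNormal_multiVeblen_prefixArg (a : Fin (m + 1) → Ordinal.{u}) (j : Fin (m + 1)) :
    Order.IsNormal (fun γ => multiVeblen (prefixArg a j γ)) :=
  (isNormal_multiVeblen_aux (a, j)).1

theorem isNormal_multiVeblen_veblenArg (a : Fin (m + 1) → Ordinal.{u}) (k : Fin m)
    (x : Ordinal.{u}) : Order.IsNormal (fun γ => multiVeblen (veblenArg a k x γ)) := by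
  simpa only [veblenArg_eq_prefixArg] using isNormal_multiVeblen_prefixArg _ _

theorem multiVeblen_ne_zero (a : Fin (m + 1) → Ordinal.{u}) : multiVeblen a ≠ 0 := by
  have h := isNormal_multiVeblen_aux (a, Fin.last m)
  have : multiVeblen (prefixArg a (Fin.last m) 0) ≤ multiVeblen a := by
    conv_rhs => rw [← prefixArg_last a]
    exact h.1.monotone (zero_le (a := a (Fin.last m)))
  exact ((pos_iff_ne_zero.2 h.2).trans_le this).ne'

theorem not_bddAbove_multiVeblen_fixedPoints (a : Fin (m + 1) → Ordinal.{u}) (k : Fin m)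
    (o : Ordinal.{u}) : ¬ BddAbove {γ | ∀ x < o, multiVeblen (veblenArg a k x γ) = γ} :=
  not_bddAbove_commonFixedPoints fun x _ => isNormal_multiVeblen_veblenArg a k x

/-- The definition gives this only at the last nonzero position `l`. For `k < l`, that case rewrites
`φ(a)` as the value at a lexicographically smaller tuple with the same entries before `l`, to which
induction applies. -/
theorem multiVeblen_veblenArg_self {k : Fin m} {x : Ordinal.{u}} (hx : x < a k.castSucc) :
    multiVeblen (veblenArg a k x (multiVeblen a)) = multiVeblen a := by
  induction a using toLex_pi_induction generalizing k x with
  | h a ih =>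
  obtain ⟨l, hkl, hl⟩ := exists_isLastNonzero hx.ne_bot
  have key : ∀ y < a l.castSucc, multiVeblen (veblenArg a l y (multiVeblen a)) = multiVeblen a := by
    have := enumOrd_mem (not_bddAbove_multiVeblen_fixedPoints a l (a l.castSucc)) (a (Fin.last m))
    rwa [← multiVeblen_of_isLastNonzero hl] at this
  rcases hkl.eq_or_lt with rfl | hkl
  · exact key x hx
  · have h0 : 0 < a l.castSucc := pos_iff_ne_zero.2 hl.1
    have hlt : ∀ i < l.castSucc, veblenArg a l 0 (multiVeblen a) i = a i := fun i hi => if_pos hi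
    have hkl' : k.castSucc < l.castSucc := by simpa using hkl
    have := ih _ (veblenArg_lt a l 0 (multiVeblen a) h0) (k := k) (x := x) (by rwa [hlt _ hkl'])
    rwa [key 0 h0, veblenArg_congr fun i hi => hlt i (hi.trans hkl')] at this

/-- The values of the Veblen function are powers of `ω`. -/
theorem exists_multiVeblen_eq_opow (a : Fin (m + 1) → Ordinal.{u}) :
    ∃ c : Ordinal.{u}, multiVeblen a = ω ^ c := by
  induction a using toLex_pi_induction with
  | h a ih =>
  by_cases h : ∀ k : Fin m, a k.castSucc = 0
  · exact ⟨_, multiVeblen_of_forall_eq_zero h⟩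
  · push Not at h
    obtain ⟨k, hk⟩ := h
    have h0 := pos_iff_ne_zero.2 hk
    rw [← multiVeblen_veblenArg_self h0]
    exact ih _ (veblenArg_lt a k 0 _ h0)

theorem multiVeblen_prefixArg_monotone (a : Fin (m + 1) → Ordinal.{u}) :
    Monotone fun i => multiVeblen (prefixArg a i (a i)) := by
  refine Fin.monotone_iff_le_succ.2 fun l => ?_
  rw [← prefixArg_succ_zero]
  exact (isNormal_multiVeblen_prefixArg a l.succ).monotone (zero_le (a := a l.succ))

theorem multiVeblen_prefixArg_lt {i j : Fin (m + 1)} (hij : i < j) (hj : a j ≠ 0) :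
    multiVeblen (prefixArg a i (a i)) < multiVeblen (prefixArg a j (a j)) := by
  obtain ⟨l, rfl⟩ := Fin.exists_succ_eq.2 (Fin.ne_zero_of_lt hij)
  have h := multiVeblen_prefixArg_monotone a (Fin.le_castSucc_iff.2 hij)
  refine h.trans_lt ?_
  dsimp only
  rw [← prefixArg_succ_zero]
  exact (isNormal_multiVeblen_prefixArg a l.succ).strictMono (pos_iff_ne_zero.2 hj)

theorem multiVeblen_prefixArg_le (a : Fin (m + 1) → Ordinal.{u}) (i : Fin (m + 1)) :
    multiVeblen (prefixArg a i (a i)) ≤ multiVeblen a := by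
  have := multiVeblen_prefixArg_monotone a (Fin.le_last i)
  dsimp only at this
  rwa [prefixArg_last] at this

theorem le_multiVeblen_prefixArg (a : Fin (m + 1) → Ordinal.{u}) (i : Fin (m + 1)) :
    a i ≤ multiVeblen (prefixArg a i (a i)) :=
  (isNormal_multiVeblen_prefixArg a i).strictMono.le_apply

theorem le_multiVeblen (a : Fin (m + 1) → Ordinal.{u}) (i : Fin (m + 1)) : a i ≤ multiVeblen a :=
  (le_multiVeblen_prefixArg a i).trans (multiVeblen_prefixArg_le a i)

theorem lt_multiVeblen_of_lt {i j : Fin (m + 1)} (hij : i < j) (hj : a j ≠ 0) :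
    a i < multiVeblen a :=
  (le_multiVeblen_prefixArg a i).trans_lt
    ((multiVeblen_prefixArg_lt hij hj).trans_le (multiVeblen_prefixArg_le a j))

theorem multiVeblen_prefixArg_eq {k : Fin m} (hab : ∀ i < k.castSucc, a i = b i)
    (hk : a k.castSucc < b k.castSucc) {i : Fin (m + 1)} (hi : k.castSucc < i)
    (h : ∀ j, k.castSucc < j → j < i → a j < multiVeblen b) :
    multiVeblen (prefixArg a i (multiVeblen b)) = multiVeblen b := by
  induction i using Fin.induction with
  | zero => simp at hi
  | succ l ih =>
    rcases (Fin.le_castSucc_iff.2 hi).eq_or_lt with hkl | hkl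
    · obtain rfl : k = l := by simpa using hkl
      rw [← veblenArg_eq_prefixArg_of_eq hab rfl]
      exact multiVeblen_veblenArg_self hk
    · have ih := ih hkl fun j hj hjl => h j hj (hjl.trans Fin.castSucc_lt_succ)
      -- By induction this tuple has value `φ(b)`. Its `l`-th entry `φ(b)` exceeds `a l`, so its
      -- fixed point identity moves `φ(b)` one place to the right.
      have hc := multiVeblen_veblenArg_self (a := prefixArg a l.castSucc (multiVeblen b)) (k := l)
        (x := a l.castSucc)
        (by rw [prefixArg_self]; exact h _ hkl Fin.castSucc_lt_succ)
      rwa [ih, veblenArg_eq_prefixArg_of_eq (b := a)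
        (fun i hi => (prefixArg_of_lt _ hi).symm) rfl] at hc

/-- With the other entries of `a` kept, `φ(b)` is a fixed point in the last variable; strict
monotonicity there compares the last entry of `a` with `φ(b)`. -/
theorem multiVeblen_lt_of_lex {k : Fin m} (hab : ∀ i < k.castSucc, a i = b i)
    (hk : a k.castSucc < b k.castSucc) (h : ∀ j, k.castSucc < j → a j < multiVeblen b) :
    multiVeblen a < multiVeblen b := by
  rw [← multiVeblen_prefixArg_eq hab hk (Fin.castSucc_lt_last k) fun j hj _ => h j hj]
  conv_lhs => rw [← prefixArg_last a]
  exact (isNormal_multiVeblen_prefixArg a _).strictMono (h _ (Fin.castSucc_lt_last k))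

theorem multiVeblen_monotone : Monotone (multiVeblen : (Fin (m + 1) → Ordinal.{u}) → _) := by
  intro a b hab
  rcases (Pi.toLex_monotone hab).eq_or_lt with heq | ⟨k, hlt, hk⟩
  · rw [show a = b from heq]
  replace hlt : ∀ j < k, a j = b j := hlt
  replace hk : a k < b k := hk
  rcases Fin.eq_castSucc_or_eq_last k with ⟨k, rfl⟩ | rfl
  · by_cases h : ∀ j, k.castSucc < j → a j < multiVeblen b
    · exact (multiVeblen_lt_of_lex hlt hk h).le
    -- Otherwise some `a j` after `k` reaches `φ(b)`, which forces `a j = b j = φ(b)`. All entries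
    -- after `j` then vanish and those of `a` before `j` and after `k` are below `φ(b)`, so `φ(a) =
    -- φ(b)`.
    · push Not at h
      obtain ⟨j, hkj, hj⟩ := h
      have hbj : b j = multiVeblen b := le_antisymm (le_multiVeblen b j) (hj.trans (hab j))
      have haj : a j = multiVeblen b := le_antisymm ((hab j).trans hbj.le) hj
      have hbj0 : b j ≠ 0 := hbj ▸ multiVeblen_ne_zero b
      have hchain := multiVeblen_prefixArg_eq hlt hk hkj fun i _ hi =>
        (hab i).trans_lt (lt_multiVeblen_of_lt hi hbj0)
      have ha : prefixArg a j (multiVeblen b) = a := by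
        funext i
        rcases lt_trichotomy i j with hi | rfl | hi
        · exact prefixArg_of_lt _ hi
        · rw [prefixArg_self, haj]
        · rw [prefixArg_of_gt _ hi]
          by_contra h0
          have : b i ≠ 0 := ((pos_iff_ne_zero.2 (Ne.symm h0)).trans_le (hab i)).ne'
          exact (lt_multiVeblen_of_lt hi this).ne hbj
      rw [← hchain, ha]
  · conv_lhs => rw [← prefixArg_last a, prefixArg_congr hlt]
    conv_rhs => rw [← prefixArg_last b]
    exact (isNormal_multiVeblen_prefixArg b _).monotone hk.le

theorem veblenArg_cons_succ (a : Fin (m + 1) → Ordinal.{u}) (k : Fin m) (x γ : Ordinal.{u}) :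
    veblenArg (Fin.cons 0 a : Fin (m + 2) → Ordinal.{u}) k.succ x γ =
      Fin.cons 0 (veblenArg a k x γ) := by
  funext i
  cases i using Fin.cases with
  | zero => simp [veblenArg, Fin.lt_def]
  | succ i => simp [veblenArg, Fin.lt_def, Fin.ext_iff]

theorem multiVeblen_cons_zero (a : Fin (m + 1) → Ordinal.{u}) :
    multiVeblen (Fin.cons 0 a : Fin (m + 2) → Ordinal.{u}) = multiVeblen a := by
  induction a using toLex_pi_induction with
  | h a ih =>
  have hlast : (Fin.cons 0 a : Fin (m + 2) → Ordinal.{u}) (Fin.last (m + 1)) = a (Fin.last m) := by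
    rw [← Fin.succ_last, Fin.cons_succ]
  have hcast : ∀ k : Fin m, (Fin.cons 0 a : Fin (m + 2) → Ordinal.{u}) k.succ.castSucc =
      a k.castSucc := fun k => by rw [← Fin.succ_castSucc, Fin.cons_succ]
  by_cases h : ∀ k : Fin m, a k.castSucc = 0
  · rw [multiVeblen_of_forall_eq_zero h, multiVeblen_of_forall_eq_zero, hlast]
    intro k
    cases k using Fin.cases with
    | zero => simp
    | succ k => rw [hcast, h]
  · push Not at h
    obtain ⟨k', hk'⟩ := h
    obtain ⟨k, -, hk⟩ := exists_isLastNonzero hk'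
    have hk2 : IsLastNonzero (Fin.cons 0 a : Fin (m + 2) → Ordinal.{u}) k.succ := by
      refine ⟨by rw [hcast]; exact hk.1, fun j hj => ?_⟩
      obtain ⟨l, rfl⟩ := Fin.exists_succ_eq.2 (Fin.ne_zero_of_lt hj)
      rw [hcast]
      exact hk.2 l (by simpa using hj)
    rw [multiVeblen_of_isLastNonzero hk, multiVeblen_of_isLastNonzero hk2, hlast, hcast]
    congr 1
    ext γ
    refine forall₂_congr fun x hx => ?_
    rw [veblenArg_cons_succ, ih _ (veblenArg_lt a k x γ hx)]

/-! ### Additively indecomposable ordinals as Veblen values -/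

/-- If the additively indecomposable ordinal `ζ` is not a value of the Veblen function at arguments
below `ζ`, then it is a fixed point of the Veblen function in the last variable, when the other
arguments are below `ζ`. -/
theorem multiVeblen_prefixArg_last_eq_self {ζ c : Ordinal.{u}} (hc : ζ = ω ^ c)
    (h : ∀ a : Fin (m + 1) → Ordinal.{u}, (∀ i, a i < ζ) → multiVeblen a ≠ ζ)
    (hb : ∀ i, b i < ζ) : multiVeblen (prefixArg b (Fin.last m) ζ) = ζ := by
  have hpos : 0 < ζ := pos_of_gt (hb 0)
  have hfix : ω ^ ζ = ζ := by
    have hle : c ≤ ζ := hc ▸ (isNormal_opow one_lt_omega0).strictMono.le_apply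
    rcases hle.eq_or_lt with rfl | hlt
    · exact hc.symm
    · refine absurd ?_ (h (prefixArg 0 (Fin.last m) c) fun i => ?_)
      · rw [multiVeblen_of_forall_eq_zero, prefixArg_self, hc]
        intro k
        rw [prefixArg_of_lt _ (Fin.castSucc_lt_last k)]
        rfl
      · unfold prefixArg
        split_ifs
        exacts [hpos, hlt, hpos]
  have hlim : Order.IsSuccLimit ζ := by
    rw [← hfix]
    exact isSuccLimit_opow_left isSuccLimit_omega0 hpos.ne'
  induction b using toLex_pi_induction with
  | h b ih =>
  by_cases h0 : ∀ k : Fin m, b k.castSucc = 0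
  · rw [multiVeblen_of_forall_eq_zero, prefixArg_self, hfix]
    intro k
    rw [prefixArg_of_lt _ (Fin.castSucc_lt_last k), h0]
  · push Not at h0
    obtain ⟨k', hk'⟩ := h0
    obtain ⟨k, -, hk⟩ := exists_isLastNonzero hk'
    -- As `ζ` is a limit, normality reduces this to arguments `y < ζ`, where the induction
    -- hypothesis bounds the values by `ζ`. Hence `ζ` is enumerated at some index `o ≤ ζ`, and `o <
    -- ζ` would make it a value at smaller arguments.
    have hmem : ζ ∈ {γ | ∀ x < b k.castSucc, multiVeblen (veblenArg b k x γ) = γ} := by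
      intro x hx
      have hN := isNormal_multiVeblen_veblenArg b k x
      refine le_antisymm ((hN.le_iff_forall_le hlim).2 fun y hy => ?_) hN.strictMono.le_apply
      have hlt : ∀ i, veblenArg b k x y i < ζ := fun i => by
        unfold veblenArg
        split_ifs
        exacts [hb i, hx.trans (hb _), hy, hpos]
      rw [← ih _ (veblenArg_lt b k x y hx) hlt]
      conv_lhs => rw [← prefixArg_last (veblenArg b k x y)]
      exact (isNormal_multiVeblen_prefixArg _ _).monotone (hlt _).le
    obtain ⟨o, ho⟩ := enumOrd_surjective (not_bddAbove_multiVeblen_fixedPoints b k _) hmem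
    have hp : ∀ o, ∀ k : Fin m, prefixArg b (Fin.last m) o k.castSucc = b k.castSucc :=
      fun o k => prefixArg_of_lt _ (Fin.castSucc_lt_last k)
    have hval : multiVeblen (prefixArg b (Fin.last m) o) = ζ := by
      have : IsLastNonzero (prefixArg b (Fin.last m) o) k := by
        simpa only [IsLastNonzero, hp] using hk
      rw [multiVeblen_of_isLastNonzero this, prefixArg_self, hp, ← ho]
      congr 1
      ext δ
      refine forall₂_congr fun x _ => ?_
      rw [veblenArg_congr fun i hi => prefixArg_of_lt _ (hi.trans (Fin.castSucc_lt_last k))]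
    have hle : o ≤ ζ := hval ▸ (isNormal_multiVeblen_prefixArg b (Fin.last m)).strictMono.le_apply
    rcases hle.eq_or_lt with rfl | hlt
    · exact hval
    · refine absurd hval (h _ fun i => ?_)
      unfold prefixArg
      split_ifs
      exacts [hb i, hlt, hpos]

/-- A leading zero can be dropped, so `φ(1, 0, …, 0)` is the least fixed point of `γ ↦ φ(γ, 0, …,
0)` with one argument fewer. -/
theorem multiVeblen_cons_one_le {ζ : Ordinal.{u}}
    (h : multiVeblen (prefixArg (0 : Fin (m + 1) → Ordinal.{u}) 0 ζ) = ζ) :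
    multiVeblen (Fin.cons 1 (fun _ : Fin (m + 1) => 0) : Fin (m + 2) → Ordinal.{u}) ≤ ζ := by
  have hl : IsLastNonzero (Fin.cons 1 (fun _ : Fin (m + 1) => 0) : Fin (m + 2) → Ordinal.{u}) 0 := by
    refine ⟨one_ne_zero, fun j hj => ?_⟩
    obtain ⟨l, rfl⟩ := Fin.exists_succ_eq.2 (Fin.ne_zero_of_lt hj)
    rw [← Fin.succ_castSucc, Fin.cons_succ]
  rw [multiVeblen_of_isLastNonzero hl, ← Fin.succ_last, Fin.cons_succ, enumOrd_zero]
  refine csInf_le' fun x hx => ?_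
  obtain rfl : x = 0 := Order.lt_one_iff.1 hx
  rw [show veblenArg (Fin.cons 1 (fun _ : Fin (m + 1) => 0) : Fin (m + 2) → Ordinal.{u}) 0 0 ζ =
    Fin.cons 0 (prefixArg 0 0 ζ) from ?_, multiVeblen_cons_zero, h]
  funext i
  cases i using Fin.cases with
  | zero => simp [veblenArg]
  | succ i =>
    rw [Fin.cons_succ]
    refine (if_neg (by simp)).trans ((if_neg (Fin.succ_ne_zero i)).trans ?_)
    simp only [prefixArg, Fin.succ_inj, Fin.not_lt_zero, if_false]

theorem multiVeblen_lt_cons_one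
    (h : ∀ i, a i < multiVeblen (Fin.cons 1 (fun _ : Fin (m + 1) => 0) : Fin (m + 2) → Ordinal.{u})) :
    multiVeblen a <
      multiVeblen (Fin.cons 1 (fun _ : Fin (m + 1) => 0) : Fin (m + 2) → Ordinal.{u}) := by
  rw [← multiVeblen_cons_zero]
  refine multiVeblen_lt_of_lex (k := 0) (fun i hi => by simp at hi) (by simp) fun j hj => ?_
  obtain ⟨l, rfl⟩ := Fin.exists_succ_eq.2 (Fin.ne_zero_of_lt hj)
  rw [Fin.cons_succ]
  exact h l

/-- Below `φ(1, 0, …, 0)`, every additively indecomposable ordinal is a value of the Veblen function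
at smaller arguments. -/
theorem exists_multiVeblen_eq {c : Ordinal.{u}}
    (hc : ω ^ c < multiVeblen (Fin.cons 1 (fun _ : Fin (m + 1) => 0) : Fin (m + 2) → Ordinal.{u})) :
    ∃ a : Fin (m + 1) → Ordinal.{u}, (∀ i, a i < ω ^ c) ∧ multiVeblen a = ω ^ c := by
  by_contra! h
  refine hc.not_ge (multiVeblen_cons_one_le ?_)
  have hpos : 0 < ω ^ c := opow_pos _ omega0_pos
  -- If `ω ^ c` is not such a value, it is closed under the Veblen function.
  have key : ∀ b : Fin (m + 1) → Ordinal.{u}, (∀ i, b i < ω ^ c) →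
      multiVeblen b < ω ^ c := fun b hb => by
    refine lt_of_le_of_ne ?_ (h b hb)
    rw [← multiVeblen_prefixArg_last_eq_self rfl h hb]
    conv_lhs => rw [← prefixArg_last b]
    exact (isNormal_multiVeblen_prefixArg _ _).monotone (hb _).le
  have h1 : ω ^ c ≠ 1 := fun h1 => by
    have := key 0 fun _ => hpos
    rw [h1, Order.lt_one_iff] at this
    exact multiVeblen_ne_zero _ this
  have hlim : Order.IsSuccLimit (ω ^ c) :=
    isSuccLimit_of_isPrincipal_add (lt_of_le_of_ne (Order.one_le_iff_pos.2 hpos) h1.symm)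
      (isPrincipal_add_omega0_opow c)
  have hN := isNormal_multiVeblen_prefixArg (0 : Fin (m + 1) → Ordinal.{u}) 0
  refine le_antisymm ((hN.le_iff_forall_le hlim).2 fun y hy => (key _ fun i => ?_).le)
    hN.strictMono.le_apply
  unfold prefixArg
  split_ifs
  exacts [hpos, hy, hpos]

end multiVeblen

/-! ### Realizing a monotone operation on the reals -/

/-- A well-founded linear order in which every element other than `x₀` is the value of a fixed
finitary operation at smaller elements is countable. -/
theorem countable_of_forall_exists_lt {X : Type u} [LinearOrder X] [WellFoundedLT X] {n : ℕ}
    (h : (Fin n → X) → X) (x₀ : X) (hgen : ∀ x ≠ x₀, ∃ s, (∀ i, s i < x) ∧ h s = x) :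
    Countable X := by
  -- Terms over one constant (`false`) and one `n`-ary symbol (`true`) form a countable W-type, and
  -- evaluation is onto.
  let β : Bool → Type := fun b => Fin (cond b n 0)
  let ev : WType β → X := WType.elim X fun p => match p with
    | ⟨true, s⟩ => h s
    | ⟨false, _⟩ => x₀
  let _ : ∀ b, Encodable (β b) := fun b => inferInstanceAs (Encodable (Fin _))
  let _ : ∀ b, Fintype (β b) := fun b => inferInstanceAs (Fintype (Fin _))
  refine Function.Surjective.countable (f := ev) fun x => ?_
  induction x using WellFoundedLT.induction with
  | ind x ih =>
  by_cases hx : x = x₀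
  · exact ⟨⟨false, Fin.elim0⟩, hx.symm⟩
  · obtain ⟨s, hs, rfl⟩ := hgen x hx
    choose t ht using fun i => ih (s i) (hs i)
    exact ⟨⟨true, t⟩, congrArg h (funext ht)⟩

/-- The continuous function that is `0` up to `c - w`, is `1` from `c` on, and is affine in
between. -/
noncomputable def ramp (c w x : ℝ) : ℝ := max 0 (min 1 ((x - (c - w)) / w))

theorem continuous_ramp (c w : ℝ) : Continuous (ramp c w) := by
  unfold ramp
  fun_prop

theorem ramp_nonneg (c w x : ℝ) : 0 ≤ ramp c w x := le_max_left _ _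

theorem ramp_le_one (c w x : ℝ) : ramp c w x ≤ 1 := max_le zero_le_one (min_le_left _ _)

theorem ramp_monotone {w : ℝ} (hw : 0 < w) (c : ℝ) : Monotone (ramp c w) := fun x y hxy => by
  unfold ramp
  gcongr

theorem ramp_of_le {c w x : ℝ} (hw : 0 < w) (h : c ≤ x) : ramp c w x = 1 := by
  have : 1 ≤ (x - (c - w)) / w := (one_le_div hw).2 (by linarith)
  simp [ramp, this]

theorem ramp_of_le_sub {c w x : ℝ} (hw : 0 < w) (h : x ≤ c - w) : ramp c w x = 0 := by
  have : (x - (c - w)) / w ≤ 0 := div_nonpos_of_nonpos_of_nonneg (by linarith) hw.le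
  simp [ramp, this]

/-- An upper set of tuples in a well order is detected by a continuous monotone function. -/
theorem exists_continuous_indicator {X : Type*} [LinearOrder X] [WellFoundedLT X] {n : ℕ}
    (e w : X → ℝ) (hw : ∀ x, 0 < w x) (hmono : Monotone e) (he : ∀ x y, x < y → e x ≤ e y - w y)
    {U : Set (Fin n → X)} (hU : IsUpperSet U) :
    ∃ p : (Fin n → ℝ) → ℝ, Continuous p ∧ Monotone p ∧ (∀ x, 0 ≤ p x) ∧ (∀ x, p x ≤ 1) ∧
      (∀ s ∈ U, p (fun i => e (s i)) = 1) ∧ ∀ s ∉ U, p (fun i => e (s i)) = 0 := by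
  -- Finite powers of a well order are well quasi-ordered, so the antichain of minimal elements of
  -- `U` is finite.
  have hpwo : U.IsPWO := Set.isPWO_of_wellQuasiOrderedLE U
  have hfin : {s | Minimal (· ∈ U) s}.Finite :=
    (setOfPred_minimal_antichain _).finite_of_partiallyWellOrderedOn
      (hpwo.mono fun s hs => hs.prop)
  let q : (Fin n → X) → (Fin n → ℝ) → ℝ := fun s x => ∏ i, ramp (e (s i)) (w (s i)) (x i)
  have hq0 : ∀ s x, 0 ≤ q s x := fun s x => Finset.prod_nonneg fun i _ => ramp_nonneg _ _ _
  have hq1 : ∀ s x, q s x ≤ 1 := fun s x =>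
    Finset.prod_le_one (fun i _ => ramp_nonneg _ _ _) fun i _ => ramp_le_one _ _ _
  -- A continuous disjunction over the minimal elements `s`, where `q s` tests whether the point
  -- dominates `s`.
  refine ⟨fun x => 1 - ∏ s ∈ hfin.toFinset, (1 - q s x), ?_, ?_, ?_, ?_, ?_, ?_⟩
  · have : ∀ s, Continuous (q s) := fun s => continuous_finsetProd _ fun i _ =>
      (continuous_ramp _ _).comp (continuous_apply i)
    fun_prop
  · intro x y hxy
    refine sub_le_sub_left (Finset.prod_le_prod (fun s _ => sub_nonneg.2 (hq1 s y)) fun s _ => ?_) _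
    exact sub_le_sub_left (Finset.prod_le_prod (fun i _ => ramp_nonneg _ _ _)
      fun i _ => ramp_monotone (hw _) _ (hxy i)) _
  · intro x
    exact sub_nonneg.2 (Finset.prod_le_one (fun s _ => sub_nonneg.2 (hq1 s x))
      fun s _ => sub_le_self _ (hq0 s x))
  · intro x
    exact sub_le_self _ (Finset.prod_nonneg fun s _ => sub_nonneg.2 (hq1 s x))
  · intro s hs
    obtain ⟨t, hts, ht⟩ := hpwo.exists_le_minimal hs
    have ht' : t ∈ hfin.toFinset := by simpa using ht
    refine (sub_eq_self).2 (Finset.prod_eq_zero ht' ?_)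
    rw [sub_eq_zero, eq_comm]
    exact Finset.prod_eq_one fun i _ => ramp_of_le (hw _) (hmono (hts i))
  · intro s hs
    refine sub_eq_zero.2 (Finset.prod_eq_one fun t ht => ?_).symm
    have ht : Minimal (· ∈ U) t := by simpa using ht
    obtain ⟨i, hi⟩ : ∃ i, s i < t i := by
      by_contra! h
      exact hs (hU h ht.prop)
    rw [sub_eq_self]
    exact Finset.prod_eq_zero (Finset.mem_univ i) (ramp_of_le_sub (hw _) (he _ _ hi))

/-- A monotone operation on a countable well order is realized by a continuous monotone function,
along a suitable embedding of the well order into the reals. -/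
theorem exists_continuous_monotone_extension {X : Type*} [LinearOrder X] [WellFoundedLT X]
    [Countable X] {n : ℕ} {h : (Fin n → X) → X} (hh : Monotone h) {x₀ : X} (hx₀ : ∀ x, x₀ ≤ x) :
    ∃ e : X → ℝ, StrictMono e ∧ e x₀ = 0 ∧ ∃ g : (Fin n → ℝ) → ℝ, Continuous g ∧ Monotone g ∧
      ∀ s, g (fun i => e (s i)) = e (h s) := by
  classical
  let _ := Encodable.ofCountable X
  obtain ⟨w, hw, C, hC, -⟩ := posSumOfEncodable one_pos X
  have hs : Summable w := hC.summable
  -- Counting `y = x` in the sum leaves a gap of length at least `w x` to the left of `e x`, where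
  -- the ramp at `e x` rises. Subtracting `w x₀` gives `e x₀ = 0`.
  let e : X → ℝ := fun x => ∑' y, (Set.Iic x).indicator w y - w x₀
  have hind : ∀ x, Summable ((Set.Iic x).indicator w) := fun x => hs.indicator _
  have hle : ∀ x y, x < y → e x ≤ e y - w y := fun x y hxy => by
    have h2 := hasSum_ite_eq y (w y)
    have h3 : ∀ z, (Set.Iic x).indicator w z + (if z = y then w y else 0) ≤
        (Set.Iic y).indicator w z := fun z => ?_
    · have := hasSum_le h3 ((hind x).hasSum.add h2) (hind y).hasSum
      simp only [e]
      linarith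
    · by_cases hz : z = y
      · simp [hz, hxy]
      · by_cases hzx : z ≤ x
        · simp [hz, hzx, hzx.trans hxy.le]
        · simpa [hz, hzx] using Set.indicator_nonneg (fun z _ => (hw z).le) z
  have hmono : StrictMono e := fun x y hxy => by linarith [hle x y hxy, hw y]
  have he0 : e x₀ = 0 := by
    simp only [e]
    rw [tsum_eq_single x₀ fun y hy => ?_]
    · simp
    · exact Set.indicator_of_notMem (s := Set.Iic x₀) (fun hle => hy (le_antisymm hle (hx₀ y))) _
  have hU : ∀ c, IsUpperSet {s | c ≤ h s} := fun c s t hst hs => hs.trans (hh hst)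
  choose p hpc hpm hp0 hp1 hpU hpU' using fun c =>
    exists_continuous_indicator e w hw hmono.monotone hle (hU c)
  have hb : ∀ c x, w c * p c x ≤ w c := fun c x => mul_le_of_le_one_right (hw c).le (hp1 c x)
  have hb0 : ∀ c x, 0 ≤ w c * p c x := fun c x => mul_nonneg (hw c).le (hp0 c x)
  have hsum : ∀ x, Summable fun c => w c * p c x := fun x =>
    hs.of_nonneg_of_le (fun c => hb0 c x) fun c => hb c x
  -- At embedded tuples `p c` is the indicator of `c ≤ h s`, so this series is the one defining `e
  -- (h s)`. Domination by `w` gives continuity.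
  refine ⟨e, hmono, he0, fun x => ∑' c, w c * p c x - w x₀, ?_, fun x y hxy => ?_, fun s => ?_⟩
  · refine (continuous_tsum (fun c => (hpc c).const_mul _) hs fun c x => ?_).sub continuous_const
    rw [Real.norm_of_nonneg (hb0 c x)]
    exact hb c x
  · exact sub_le_sub_right ((hsum x).tsum_le_tsum
      (fun c => mul_le_mul_of_nonneg_left (hpm c hxy) (hw c).le) (hsum y)) _
  · simp only [e]
    congr 2
    funext c
    by_cases hc : c ≤ h s
    · rw [hpU c s hc, mul_one, Set.indicator_of_mem (Set.mem_Iic.2 hc)]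
    · rw [hpU' c s hc, mul_zero, Set.indicator_of_notMem (mt Set.mem_Iic.1 hc)]

/-! ### The generating operation on ordinals -/

open Classical in
/-- The largest of `1`, the sum of the entries at `p` and `q`, and, if the leading entry is
`1 + ξ`, the value of the Veblen function with the leading entry replaced by `ξ`. -/
noncomputable def addVeblen {m : ℕ} (p q : Fin (m + 1)) (x : Fin (m + 1) → Ordinal.{u}) :
    Ordinal.{u} :=
  max (max 1 (x p + x q))
    (if x 0 = 0 then 0 else multiVeblen (Function.update x 0 (x 0 - 1)))

section addVeblen

variable {m : ℕ} {p q : Fin (m + 1)}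

theorem addVeblen_monotone : Monotone (addVeblen p q : (Fin (m + 1) → Ordinal.{u}) → _) := by
  intro x y hxy
  refine max_le_max (max_le_max le_rfl (add_le_add (hxy p) (hxy q))) ?_
  by_cases hx : x 0 = 0
  · simp [hx]
  · have hy : y 0 ≠ 0 := ((pos_iff_ne_zero.2 hx).trans_le (hxy 0)).ne'
    rw [if_neg hx, if_neg hy]
    refine multiVeblen_monotone (update_le_update_iff.2 ⟨?_, fun i _ => hxy i⟩)
    exact Ordinal.sub_le.2 ((hxy 0).trans (Ordinal.le_add_sub _ _))

theorem addVeblen_lt {x : Fin (m + 1) → Ordinal.{u}} (h : ∀ i, x i <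
      multiVeblen (Fin.cons 1 (fun _ : Fin (m + 1) => 0) : Fin (m + 2) → Ordinal.{u})) :
    addVeblen p q x <
      multiVeblen (Fin.cons 1 (fun _ : Fin (m + 1) => 0) : Fin (m + 2) → Ordinal.{u}) := by
  set l := multiVeblen (Fin.cons 1 (fun _ : Fin (m + 1) => 0) : Fin (m + 2) → Ordinal.{u}) with hl
  have hpos : 0 < l := pos_iff_ne_zero.2 (multiVeblen_ne_zero _)
  refine max_lt (max_lt ?_ ?_) ?_
  · refine (Order.one_le_iff_pos.2 (pos_iff_ne_zero.2 (multiVeblen_ne_zero _))).trans_lt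
      (multiVeblen_lt_cons_one (a := 0) fun _ => hpos)
  · obtain ⟨c, hc⟩ := exists_multiVeblen_eq_opow
      (Fin.cons 1 (fun _ : Fin (m + 1) => 0) : Fin (m + 2) → Ordinal.{u})
    rw [← hl] at hc
    have := isPrincipal_add_omega0_opow c
    rw [← hc] at this
    exact this (h p) (h q)
  · split_ifs
    · exact hpos
    · refine multiVeblen_lt_cons_one fun i => ?_
      rcases eq_or_ne i 0 with rfl | hi
      · rw [Function.update_self]
        exact (Ordinal.sub_le_self _ _).trans_lt (h 0)
      · rw [Function.update_of_ne hi]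
        exact h i

theorem exists_addVeblen_eq (hp : p ≠ 0) (hq : q ≠ 0) (hpq : p ≠ q) {α : Ordinal.{u}} (h0 : α ≠ 0)
    (hα : α <
      multiVeblen (Fin.cons 1 (fun _ : Fin (m + 1) => 0) : Fin (m + 2) → Ordinal.{u})) :
    ∃ x : Fin (m + 1) → Ordinal.{u}, (∀ i, x i < α) ∧ addVeblen p q x = α := by
  have hpos : 0 < α := pos_iff_ne_zero.2 h0
  have hone : 1 ≤ α := Order.one_le_iff_pos.2 hpos
  by_cases hprin : IsPrincipal (· + ·) α
  · rcases hone.eq_or_lt with rfl | h1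
    · exact ⟨0, fun _ => hpos, by simp [addVeblen]⟩
    · obtain h | ⟨c, rfl⟩ := isPrincipal_add_iff_zero_or_omega0_opow.1 hprin
      · exact absurd h h0
      · obtain ⟨a, ha, hac⟩ := exists_multiVeblen_eq hα
        -- The shift is `1 + a 0`, not `a 0 + 1`, because ordinal subtraction cancels on the left.
        -- Indecomposability keeps it below `ω ^ c` and stops the sum term from exceeding `ω ^ c`.
        refine ⟨Function.update a 0 (1 + a 0), fun i => ?_, ?_⟩
        · rcases eq_or_ne i 0 with rfl | hi
          · rw [Function.update_self]
            exact hprin h1 (ha 0)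
          · rw [Function.update_of_ne hi]
            exact ha i
        · rw [addVeblen, Function.update_self, if_neg (by simp), Ordinal.add_sub_cancel,
            Function.update_idem, Function.update_eq_self, hac, Function.update_of_ne hp,
            Function.update_of_ne hq]
          exact max_eq_right (max_le hone (hprin (ha p) (ha q)).le)
  · obtain ⟨b, hb, c, hc, rfl⟩ := exists_lt_add_of_not_isPrincipal_add hprin
    -- The leading entry stays `0`, which disables the Veblen term and leaves `b + c`.
    refine ⟨Function.update (Function.update 0 p b) q c, fun i => ?_, ?_⟩
    · rcases eq_or_ne i q with rfl | hiq
      · rwa [Function.update_self]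
      · rw [Function.update_of_ne hiq]
        rcases eq_or_ne i p with rfl | hip
        · rwa [Function.update_self]
        · rwa [Function.update_of_ne hip]
    · rw [addVeblen, if_pos, Function.update_self, Function.update_of_ne hpq, Function.update_self,
        max_eq_right hone, max_eq_left hpos.le]
      rw [Function.update_of_ne hq.symm, Function.update_of_ne hp.symm]
      rfl

end addVeblen

/-! ### Order type of the generated set -/

/-- If every element of a well order other than the least one is the value of a monotone operation
at smaller elements, then some continuous monotone function generates a set of reals of the same
order type. -/
theorem exists_hasOrderType_friedmanSet {X : Type} [LinearOrder X] [WellFoundedLT X] {n : ℕ}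
    {h : (Fin n → X) → X} (hh : Monotone h) {x₀ : X} (hx₀ : ∀ x, x₀ ≤ x)
    (hgen : ∀ x ≠ x₀, ∃ s, (∀ i, s i < x) ∧ h s = x) :
    ∃ g : (Fin n → ℝ) → ℝ, Continuous g ∧ Monotone g ∧
      HasOrderType (friedmanSet {Sigma.mk n g} {0}) (Ordinal.type (α := X) (· < ·)) := by
  have := countable_of_forall_exists_lt h x₀ hgen
  obtain ⟨e, he, he0, g, hgc, hgm, hg⟩ := exists_continuous_monotone_extension hh hx₀
  refine ⟨g, hgc, hgm, ?_⟩
  have hrange : friedmanSet {Sigma.mk n g} {0} = Set.range e := by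
    refine Set.Subset.antisymm (fun z hz => ?_) ?_
    · induction hz with
      | base z hz => exact ⟨x₀, he0.trans hz.symm⟩
      | app k f hf x _ _ ih =>
        obtain ⟨rfl, hf⟩ := Sigma.mk.inj_iff.1 hf
        obtain rfl := eq_of_heq hf
        choose s hs using ih
        exact ⟨h s, by rw [← hg s, funext hs]⟩
    · rintro _ ⟨x, rfl⟩
      induction x using WellFoundedLT.induction with
      | ind x ih =>
      by_cases hx : x = x₀
      · exact .base _ (by rw [hx, he0]; rfl)
      · obtain ⟨s, hs, rfl⟩ := hgen x hx
        rw [← hg s]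
        exact .app n g (Set.mem_singleton _) (fun i => e (s i)) (fun i => ih _ (hs i)) fun i => by
          rw [hg s]
          exact he (hs i)
  rw [hrange]
  let E : X ≃o Set.range e := he.orderIso
  have hwo : IsWellOrder (Set.range e) (· < ·) := E.symm.toRelIsoLT.toRelEmbedding.isWellOrder
  exact ⟨hwo, (RelIso.ordinalType_congr E.toRelIsoLT).symm⟩

theorem theorem3 (n : ℕ) (hn : 3 ≤ n) :
    ∃ g : (Fin n → ℝ) → ℝ, Continuous g ∧ Monotone g ∧
      HasOrderType (friedmanSet {Sigma.mk n g} {0})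
        (multiVeblen (Fin.cons 1 (fun _ : Fin n => 0) : Fin (n + 1) → Ordinal.{0})) := by
  obtain ⟨m, rfl⟩ : ∃ m, n = m + 1 := ⟨n - 1, by omega⟩
  set l := multiVeblen (Fin.cons 1 (fun _ : Fin (m + 1) => 0) : Fin (m + 2) → Ordinal.{0}) with hl
  -- Two distinct summand positions away from the leading one exist because `3 ≤ n`.
  let p : Fin (m + 1) := ⟨1, by omega⟩
  let q : Fin (m + 1) := ⟨2, by omega⟩
  have hp : p ≠ 0 := by simp [p, Fin.ext_iff]
  have hq : q ≠ 0 := by simp [q, Fin.ext_iff]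
  have hpq : p ≠ q := by simp [p, q]
  let φ : Set.Iio l ≃o l.ToType := Ordinal.ToType.mk
  have hlt : ∀ s : Fin (m + 1) → l.ToType,
      addVeblen p q (fun i => (φ.symm (s i) : Ordinal.{0})) < l :=
    fun s => addVeblen_lt fun i => (φ.symm (s i)).2
  have hpos : 0 < l := pos_iff_ne_zero.2 (multiVeblen_ne_zero _)
  rw [← Ordinal.type_toType l]
  refine exists_hasOrderType_friedmanSet (h := fun s => φ ⟨_, hlt s⟩) (x₀ := φ ⟨0, hpos⟩)
    (fun s t hst => ?_) (fun x => ?_) fun x hx => ?_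
  · refine φ.monotone (Subtype.mk_le_mk.2 (addVeblen_monotone fun i => ?_))
    exact φ.symm.monotone (hst i)
  · rw [← φ.apply_symm_apply x]
    exact φ.monotone (Subtype.mk_le_mk.2 zero_le)
  · obtain ⟨⟨α, hα⟩, rfl⟩ := φ.surjective x
    have hα0 : α ≠ 0 := by
      rintro rfl
      exact hx rfl
    obtain ⟨a, ha, rfl⟩ := exists_addVeblen_eq hp hq hpq hα0 hα
    refine ⟨fun i => φ ⟨a i, (ha i).trans hα⟩, fun i => φ.strictMono (ha i), ?_⟩
    simp only [OrderIso.symm_apply_apply]
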